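/- Let $k,L$ be positive integers. Let $\mathbb{Z}^k$ act by homeomorphisms on a compact metric space $(X,d)$. For $n\ge 1$ put $[n]=\{0,\dots,n-1\}^k\subset\mathbb{Z}^k$ and $d_{[n]}(x,y)=\max_{g\in[n]}d(gx,gy)$, and let the mean dimension of the action be $$\mathrm{mdim}(X)=\sup_{\epsilon>0}\ \lim_{n\to\infty}\frac{\mathrm{Widim}_\epsilon(X,d_{[n]})}{n^k}\in[0,\infty],$$ where $\mathrm{Widim}_\epsilon(X,\rho)$ is the smallest integer $m\ge 0$ such that $X$ has a finite open cover whose members have $\rho$-diameter at most $\epsilon$ and such that every point of $X$ lies in at most $m+1$ of its members (the limit exists by the Ornstein--Weiss lemma). Let $\alpha_1,\dots,\alpha_k$ be irrational real numbers (not necessarily linearly independent over $\mathbb{Q}$), and consider the irrational $\mathbb{Z}^k$-rotation $(n_1,\dots,n_k)\cdot(x_1,\dots,x_k)=(x_1+n_1\alpha_1,\dots,x_k+n_k\alpha_k)$ on $\mathbb{T}^k=(\mathbb{R}/\mathbb{Z})^k$. Suppose that $(X,\mathbb{Z}^k)$ is an extension of this rotation, i.e. there is a continuous surjective $\mathbb{Z}^k$-equivariant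 map $X\to\mathbb{T}^k$, and that $\mathrm{mdim}(X)<L/2$. Then $(X,\mathbb{Z}^k)$ embeds into the cubical shift $\bigl(([0,1]^{2^kL+1})^{\mathbb{Z}^k},\sigma\bigr)$, where $\sigma(m,(x_n)_{n\in\mathbb{Z}^k})=(x_{n+m})_{n\in\mathbb{Z}^k}$: there is a continuous injective map $f:X\to([0,1]^{2^kL+1})^{\mathbb{Z}^k}$ with $f(mx)=\sigma(m,f(x))$ for all $m\in\mathbb{Z}^k$ and $x\in X$. -/

import Mathlib

open scoped ENNReal

noncomputable section

namespace MeanDim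

/-- The group `ℤ^k`, acting (in additive notation `n +ᵥ x`) on the spaces below. -/
abbrev Zk (k : ℕ) : Type := Fin k → ℤ

/-- The `k`-torus `𝕋^k = (ℝ/ℤ)^k`. -/
abbrev Torus (k : ℕ) : Type := Fin k → UnitAddCircle

/-- `d_[n](x, y) = max_{g ∈ [n]} d(g x, g y)`, where `[n] = {0, …, n-1}^k ⊂ ℤ^k`
(a maximum over a finite index set, which is nonempty for `n ≥ 1`). -/
def boxDist (k : ℕ) {X : Type*} [MetricSpace X] [AddAction (Zk k) X] (n : ℕ) (x y : X) : ℝ :=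
  ⨆ g : Fin k → Fin n,
    dist ((fun i => ((g i : ℕ) : ℤ) : Zk k) +ᵥ x) ((fun i => ((g i : ℕ) : ℤ) : Zk k) +ᵥ y)

/-- `U` is a finite open cover of `X`. -/
def IsFiniteOpenCover {X : Type*} [TopologicalSpace X] (U : Set (Set X)) : Prop :=
  U.Finite ∧ (∀ V ∈ U, IsOpen V) ∧ ⋃₀ U = Set.univ

/-- The mesh of `U` for the distance function `d` is at most `ε`. -/
def MeshLE {X : Type*} (d : X → X → ℝ) (U : Set (Set X)) (ε : ℝ) : Prop :=
  ∀ V ∈ U, ∀ x ∈ V, ∀ y ∈ V, d x y ≤ ε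

/-- The order `max_x #{V ∈ U : x ∈ V} - 1` of the (finite) cover `U` is at most `m`. -/
def OrderLE {X : Type*} (U : Set (Set X)) (m : ℕ) : Prop :=
  ∀ x, {V ∈ U | x ∈ V}.ncard ≤ m + 1

/-- `Widim_ε(X, d)`: the smallest `m` such that `X` has a finite open cover of `d`-mesh at most `ε`
and of order `m` (it is `⊤` if there is no such cover, which does not happen for the continuous
distance functions used below on a compact space). -/
def widim {X : Type*} [TopologicalSpace X] (ε : ℝ) (d : X → X → ℝ) : ℕ∞ :=
  ⨅ (m : ℕ) (_ : ∃ U : Set (Set X), IsFiniteOpenCover U ∧ MeshLE d U ε ∧ OrderLE U m), (m : ℕ∞)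

/-- The mean dimension `sup_{ε > 0} lim_{n → ∞} Widim_ε(X, d_[n]) / n^k` of a `ℤ^k`-action, with
values in `[0, ∞]`. For a continuous action on a compact metric space the limit exists by the
Ornstein–Weiss lemma, so that it is the lower limit. -/
def mdim (k : ℕ) (X : Type*) [MetricSpace X] [AddAction (Zk k) X] : ℝ≥0∞ :=
  ⨆ (ε : ℝ) (_ : 0 < ε),
    Filter.liminf (fun n : ℕ => ((widim ε (boxDist k (X := X) n) : ℕ∞) : ℝ≥0∞) / (n : ℝ≥0∞) ^ k)
      Filter.atTop

/-- The rotation `(n, x) ↦ (x₁ + n₁ α₁, …, x_k + n_k α_k)` of `ℤ^k` on `𝕋^k`. -/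
def torusRotation {k : ℕ} (α : Fin k → ℝ) (n : Zk k) (x : Torus k) : Torus k :=
  fun i => x i + (((n i : ℝ) * α i : ℝ) : UnitAddCircle)

/-- The phase space `([0,1]^d)^{ℤ^k}` of the `d`-cubical shift, with the product topology. -/
abbrev CubicalShift (k d : ℕ) : Type := Zk k → Fin d → unitInterval

/-- The shift `σ(m, (x_n)_n) = (x_{n+m})_n`. -/
def shift {k d : ℕ} (m : Zk k) (x : CubicalShift k d) : CubicalShift k d :=
  fun n => x (n + m)

/-- `π` is a factor map from the system `X` onto the system `(Y, S)`,
i.e. `X` is an extension of `(Y, S)` through `π`. -/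
structure IsFactorMap {k : ℕ} {X Y : Type*} [TopologicalSpace X] [TopologicalSpace Y]
    [AddAction (Zk k) X] (S : Zk k → Y → Y) (π : X → Y) : Prop where
  continuous : Continuous π
  surjective : Function.Surjective π
  equivariant : ∀ (n : Zk k) (x : X), π (n +ᵥ x) = S n (π x)

/-- `f` is an embedding of the system `X` into the system `(Y, S)`. -/
structure IsSystemEmbedding {k : ℕ} {X Y : Type*} [TopologicalSpace X] [TopologicalSpace Y]
    [AddAction (Zk k) X] (S : Zk k → Y → Y) (f : X → Y) : Prop where
  continuous : Continuous f
  injective : Function.Injective f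
  equivariant : ∀ (n : Zk k) (x : X), f (n +ᵥ x) = S n (f x)

end MeanDim

end

open scoped ENNReal

namespace MeanDim

/-! One coordinate recovers the torus point: the orbit of `∑ ‖π x i‖` does so because the `i`-th
circle is moved by `n i` alone, so a single `n` brings all coordinates near `0`; no joint
independence of the `α i` is needed. The other `2 ^ k * L` coordinates have to separate points
inside fibres of `π`, and Baire category provides them: separation at scale `ε` is an open
(`isOpen_fibreSeparating`) and dense (`dense_fibreSeparating`) condition. For density, `mdim < L /
2` gives a box `[N]` on which a general-position map into `N ^ k * L` dimensions approximates the
orbit of `F` and is injective up to `δ` (`exists_box_approx`). Choosing `m i • α i` close to `1 / N`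
turns the torus into `2 ^ k` families of towers over boxes: each family has disjoint levels, and
together they cover. Each colour gets its own `L` coordinates, into which `exists_perturbation`
writes the box map along the levels. -/

/-! ### General position and approximation on a box. -/

theorem exists_near_linearIndepOn {κ ι : Type*} [Finite κ] [Fintype ι] (a : κ → ι → ℝ)
    {η : ℝ} (hη : 0 < η) :
    ∃ u : κ → ι → ℝ, (∀ v, dist (u v) (a v) < η) ∧
      ∀ s : Finset κ, s.card ≤ Fintype.card ι → LinearIndepOn ℝ u (s : Set κ) := by
  classical
  have := Fintype.ofFinite κ
  suffices H : ∀ S : Finset κ, ∃ u : κ → ι → ℝ, (∀ v, dist (u v) (a v) < η) ∧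
      ∀ s ⊆ S, s.card ≤ Fintype.card ι → LinearIndepOn ℝ u (s : Set κ) by
    obtain ⟨u, hu, h⟩ := H Finset.univ
    exact ⟨u, hu, fun s hs => h s (Finset.subset_univ s) hs⟩
  intro S
  induction S using Finset.induction_on with
  | empty =>
    refine ⟨a, fun v => by simpa using hη, fun s hs _ => ?_⟩
    rw [Finset.subset_empty.1 hs]
    simp
  | insert v S hv ih =>
    obtain ⟨u, hu, hind⟩ := ih
    -- Fewer than `card ι` vectors span a proper closed subspace; the new vector must avoid finitely
    -- many of these.
    have hD : Dense (⋂ s ∈ {s : Finset κ | s.card < Fintype.card ι},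
        ((Submodule.span ℝ (u '' (s : Set κ)) : Set (ι → ℝ))ᶜ)) := by
      refine dense_biInter_of_isOpen (fun s _ => ?_) (Set.to_countable _) (fun s hs => ?_)
      · exact (Submodule.closed_of_finiteDimensional _).isOpen_compl
      · rw [← interior_eq_empty_iff_dense_compl]
        by_contra hne
        have htop := Submodule.eq_top_of_nonempty_interior' (R := ℝ) _
          (Set.nonempty_iff_ne_empty.2 hne)
        have h1 := finrank_span_finset_le_card (R := ℝ) (s.image u)
        rw [Finset.coe_image, Set.finrank, htop, finrank_top, Module.finrank_fintype_fun_eq_card]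
          at h1
        have h2 := Finset.card_image_le (s := s) (f := u)
        have h3 : s.card < Fintype.card ι := hs
        omega
    obtain ⟨w, hw, hwa⟩ := hD.exists_dist_lt (a v) hη
    rw [Set.mem_iInter₂] at hw
    refine ⟨Function.update u v w, fun v' => ?_, fun s hs hcard => ?_⟩
    · by_cases h : v' = v
      · subst h
        simpa [dist_comm] using hwa
      · simpa [h] using hu v'
    · have key : ∀ t : Finset κ, v ∉ t → Set.EqOn u (Function.update u v w) (t : Set κ) := by
        intro t ht x hx
        rw [Function.update_of_ne]
        rintro rfl
        exact ht hx
      by_cases hvs : v ∈ s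
      · have hve : v ∉ s.erase v := Finset.notMem_erase v s
        have hsub : s.erase v ⊆ S := by
          intro x hx
          rw [Finset.mem_erase] at hx
          exact (Finset.mem_insert.1 (hs hx.2)).resolve_left hx.1
        have hc : (s.erase v).card < Fintype.card ι := by
          have := Finset.card_erase_lt_of_mem hvs
          omega
        rw [← Finset.insert_erase hvs, Finset.coe_insert,
          linearIndepOn_insert (by exact_mod_cast hve)]
        refine ⟨(hind _ hsub hc.le).congr (key _ hve), ?_⟩
        rw [← (key _ hve).image_eq, Function.update_self]
        exact hw _ hc
      · refine (hind s (fun x hx => ?_) hcard).congr (key s hvs)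
        refine (Finset.mem_insert.1 (hs hx)).resolve_left ?_
        rintro rfl
        exact hvs hx

variable {k : ℕ}

/-- An element of the box `[N]` as an element of `ℤ^k`. -/
def boxVec {N : ℕ} (g : Fin k → Fin N) : Zk k := fun i => ((g i : ℕ) : ℤ)

theorem dist_boxVec_vadd_le_boxDist {X : Type*} [MetricSpace X] [AddAction (Zk k) X] {N : ℕ}
    (g : Fin k → Fin N) (x y : X) :
    dist (boxVec g +ᵥ x) (boxVec g +ᵥ y) ≤ boxDist k N x y :=
  le_ciSup (f := fun g : Fin k → Fin N => dist (boxVec g +ᵥ x) (boxVec g +ᵥ y))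
    (Set.finite_range _).bddAbove g

/-- Map to the nerve of `U` by a partition of unity, with vertices in general position near sampled
values of `F`. Two points involve at most `2 * (w + 1)` vertices, which are independent, so equal
images force equal barycentric coordinates and hence a common member of `U`. -/
theorem exists_box_approx {X : Type*} [MetricSpace X] [CompactSpace X] [AddAction (Zk k) X]
    {N L w : ℕ} {δ η : ℝ} (hη : 0 < η) {U : Set (Set X)} (hU : IsFiniteOpenCover U)
    (hmesh : MeshLE (boxDist k N) U δ) (hord : OrderLE U w) (hw : 2 * (w + 1) ≤ N ^ k * L)
    (F : X → Fin L → ℝ) (hF : ∀ x y, dist x y ≤ δ → dist (F x) (F y) ≤ η) :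
    ∃ G : C(X, (Fin k → Fin N) → Fin L → ℝ),
      (∀ x g, dist (G x g) (F (boxVec g +ᵥ x)) ≤ 2 * η) ∧
      ∀ x y, G x = G y → boxDist k N x y ≤ δ := by
  classical
  obtain ⟨hfin, hopen, hcov⟩ := hU
  have : Finite U := hfin
  have := Fintype.ofFinite U
  rcases isEmpty_or_nonempty X with hX | hX
  · exact ⟨⟨fun _ _ _ => 0, continuous_const⟩, fun x => hX.elim x, fun x => hX.elim x⟩
  obtain ⟨ρ, hρ⟩ := PartitionOfUnity.exists_isSubordinate (s := (Set.univ : Set X)) isClosed_univ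
    (fun V : U => (V : Set X)) (fun V => hopen V V.2)
    (by rw [← hcov, Set.sUnion_eq_iUnion])
  have hsum : ∀ x, ∑ V, ρ V x = 1 := fun x => by
    rw [← finsum_eq_sum_of_fintype]; exact ρ.sum_eq_one (Set.mem_univ x)
  have hmem : ∀ (V : U) x, ρ V x ≠ 0 → x ∈ (V : Set X) := fun V x h =>
    hρ V (subset_tsupport _ h)
  have hpt : ∀ V : U, ∃ p : X, (V : Set X).Nonempty → p ∈ (V : Set X) := fun V => by
    by_cases h : (V : Set X).Nonempty
    · exact ⟨h.some, fun _ => h.some_mem⟩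
    · exact ⟨hX.some, fun h' => absurd h' h⟩
  choose p hp using hpt
  obtain ⟨u, hu, hind⟩ := exists_near_linearIndepOn
    (fun (V : U) (j : (Fin k → Fin N) × Fin L) => F (boxVec j.1 +ᵥ p V) j.2) hη
  refine ⟨⟨fun x g l => ∑ V, ρ V x * u V (g, l), by fun_prop⟩, fun x g => ?_, fun x y hxy => ?_⟩
  · refine (dist_pi_le_iff (by positivity)).2 fun l => ?_
    have h1 : F (boxVec g +ᵥ x) l = ∑ V, ρ V x * F (boxVec g +ᵥ x) l := by
      rw [← Finset.sum_mul, hsum, one_mul]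
    have h2 : ∑ V, ρ V x * (2 * η) = 2 * η := by rw [← Finset.sum_mul, hsum, one_mul]
    rw [Real.dist_eq, h1, ← h2]
    simp only [ContinuousMap.coe_mk]
    rw [← Finset.sum_sub_distrib]
    refine (Finset.abs_sum_le_sum_abs _ _).trans (Finset.sum_le_sum fun V _ => ?_)
    rw [← mul_sub, abs_mul, abs_of_nonneg (ρ.nonneg V x)]
    by_cases h0 : ρ V x = 0
    · simp [h0]
    refine mul_le_mul_of_nonneg_left ?_ (ρ.nonneg V x)
    have hx := hmem V x h0
    have hpV := hp V ⟨x, hx⟩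
    have hd := hF _ _ ((dist_boxVec_vadd_le_boxDist g (p V) x).trans (hmesh V V.2 _ hpV _ hx))
    have hd' := (dist_le_pi_dist _ _ l).trans hd
    have hu' := (dist_le_pi_dist _ _ (g, l)).trans (hu V).le
    rw [← Real.dist_eq]
    calc _ ≤ _ := dist_triangle _ (F (boxVec g +ᵥ p V) l) _
      _ ≤ η + η := add_le_add hu' hd'
      _ = 2 * η := by ring
  · set s : X → Finset U := fun x => Finset.univ.filter fun V => ρ V x ≠ 0 with hs
    have hcard : ∀ x, (s x).card ≤ w + 1 := fun x => by
      refine le_trans ?_ (hord x)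
      have h1 : (((s x).image Subtype.val : Finset (Set X)) : Set (Set X)) ⊆ {V ∈ U | x ∈ V} := by
        intro V hV
        simp only [Finset.coe_image, Set.mem_image, Finset.mem_coe, hs, Finset.mem_filter] at hV
        obtain ⟨V', ⟨-, hV'⟩, rfl⟩ := hV
        exact ⟨V'.2, hmem V' x hV'⟩
      have h2 := Set.ncard_le_ncard h1 (hfin.subset fun V hV => hV.1)
      rwa [Set.ncard_coe_finset, Finset.card_image_of_injective _ Subtype.val_injective] at h2
    have hli := hind (s x ∪ s y) (by
      have := Finset.card_union_le (s x) (s y)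
      have h1 := hcard x
      have h2 := hcard y
      simp only [Fintype.card_prod, Fintype.card_fun, Fintype.card_fin]
      omega)
    rw [linearIndepOn_finset_iff] at hli
    have hz := hli (fun V => ρ V x - ρ V y) (by
      rw [Finset.sum_subset (Finset.subset_univ _)]
      · ext ⟨g, l⟩
        have := congrFun (congrFun hxy g) l
        simp only [ContinuousMap.coe_mk] at this
        simp [sub_mul, Finset.sum_sub_distrib, this]
      · intro V _ hV
        simp only [hs, Finset.mem_union, Finset.mem_filter, Finset.mem_univ, true_and, not_or,
          not_not] at hV
        simp [hV.1, hV.2])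
    obtain ⟨V, hV⟩ : ∃ V, ρ V x ≠ 0 := by
      by_contra! h
      simpa [h] using hsum x
    have hVy : ρ V y ≠ 0 := by
      rw [← sub_eq_zero.1 (hz V (by simp [hs, hV]))]
      exact hV
    exact hmesh V V.2 _ (hmem V x hV) _ (hmem V y hVy)

/-! ### Two-coloured towers on the circle. -/

theorem norm_coe_le_abs (x : ℝ) : ‖(x : UnitAddCircle)‖ ≤ |x| := by
  rw [UnitAddCircle.norm_eq]
  simpa using round_le x 0

/-- A pair of bump functions on the circle, centred at `0` and at `1 / (2 N)`. -/
noncomputable def circleBump (N : ℕ) (b : Bool) (t : UnitAddCircle) : ℝ :=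
  max 0 (min 1 (6 - 16 * N * ‖t - ((cond b (1 / (2 * N)) 0 : ℝ) : UnitAddCircle)‖))

theorem continuous_circleBump (N : ℕ) (b : Bool) : Continuous (circleBump N b) := by
  unfold circleBump; fun_prop

theorem circleBump_nonneg (N : ℕ) (b : Bool) (t : UnitAddCircle) : 0 ≤ circleBump N b t :=
  le_max_left _ _

theorem circleBump_le_one (N : ℕ) (b : Bool) (t : UnitAddCircle) : circleBump N b t ≤ 1 :=
  max_le zero_le_one (min_le_left _ _)

theorem circleBump_eq_one {N : ℕ} {b : Bool} {t : UnitAddCircle}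
    (h : 16 * N * ‖t - ((cond b (1 / (2 * N)) 0 : ℝ) : UnitAddCircle)‖ ≤ 5) :
    circleBump N b t = 1 := by
  rw [circleBump, min_eq_left (by linarith), max_eq_right zero_le_one]

theorem lt_of_circleBump_ne_zero {N : ℕ} {b : Bool} {t : UnitAddCircle}
    (h : circleBump N b t ≠ 0) :
    16 * N * ‖t - ((cond b (1 / (2 * N)) 0 : ℝ) : UnitAddCircle)‖ < 6 := by
  by_contra! h'
  exact h (max_eq_left ((min_le_right _ _).trans (by linarith)))

theorem norm_zsmul_sub_le {N : ℕ} (hN : 0 < N) {γ : UnitAddCircle}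
    (hγ : ‖γ - ((1 / N : ℝ) : UnitAddCircle)‖ ≤ 1 / (16 * N ^ 2)) (j : ℤ) (hj : |j| ≤ N) :
    16 * N * ‖j • γ - ((j / N : ℝ) : UnitAddCircle)‖ ≤ 1 := by
  have hN' : (0 : ℝ) < N := by exact_mod_cast hN
  have h1 : j • γ - ((j / N : ℝ) : UnitAddCircle) =
      j • (γ - ((1 / N : ℝ) : UnitAddCircle)) := by
    rw [smul_sub, ← AddCircle.coe_zsmul, zsmul_eq_mul, mul_one_div]
  have h2 : ‖j • (γ - ((1 / N : ℝ) : UnitAddCircle))‖ ≤ N * (1 / (16 * N ^ 2)) := by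
    refine (norm_zsmul_le _ _).trans (mul_le_mul ?_ hγ (norm_nonneg _) hN'.le)
    rw [Int.norm_eq_abs]
    exact_mod_cast hj
  rw [h1]
  calc _ ≤ 16 * N * (N * (1 / (16 * N ^ 2)) : ℝ) := by gcongr
    _ = 1 := by field_simp

theorem circleBump_disjoint {N : ℕ} {γ : UnitAddCircle}
    (hγ : ‖γ - ((1 / N : ℝ) : UnitAddCircle)‖ ≤ 1 / (16 * N ^ 2)) {b : Bool} {t : UnitAddCircle}
    {g g' : Fin N} (h : circleBump N b (t - ((g : ℕ) : ℤ) • γ) ≠ 0)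
    (h' : circleBump N b (t - ((g' : ℕ) : ℤ) • γ) ≠ 0) : g = g' := by
  have hN : 0 < N := g.pos
  have hN' : (0 : ℝ) < N := by exact_mod_cast hN
  by_contra hne
  have h1 := lt_of_circleBump_ne_zero h
  have h2 := lt_of_circleBump_ne_zero h'
  set s := ((cond b (1 / (2 * N)) 0 : ℝ) : UnitAddCircle)
  set j : ℤ := ((g' : ℕ) : ℤ) - ((g : ℕ) : ℤ) with hj
  have hj0 : j ≠ 0 := fun h0 => hne (Fin.ext (by omega))
  have hjN : |j| < N := by rw [abs_lt]; omega
  have h3 : ‖j • γ‖ ≤ ‖t - ((g : ℕ) : ℤ) • γ - s‖ + ‖t - ((g' : ℕ) : ℤ) • γ - s‖ := by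
    refine le_trans (le_of_eq ?_) (norm_sub_le _ _)
    congr 1
    rw [hj, sub_smul]
    abel
  have h4 := norm_zsmul_sub_le hN hγ j hjN.le
  have h5 : 1 ≤ N * ‖((j / N : ℝ) : UnitAddCircle)‖ := by
    rw [UnitAddCircle.norm_eq]
    set r := round (j / N : ℝ)
    have : N * |(j / N : ℝ) - r| = |((j - N * r : ℤ) : ℝ)| := by
      rw [← abs_of_pos hN', ← abs_mul, abs_of_pos hN']
      congr 1
      push_cast
      field_simp
    rw [this]
    have hne' : j - N * r ≠ 0 := fun h0 =>
      hj0 (Int.eq_zero_of_abs_lt_dvd ⟨r, sub_eq_zero.1 h0⟩ hjN)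
    exact_mod_cast Int.one_le_abs hne'
  have h6 : ‖((j / N : ℝ) : UnitAddCircle)‖ ≤
      ‖j • γ‖ + ‖j • γ - ((j / N : ℝ) : UnitAddCircle)‖ := by
    refine le_trans (le_of_eq ?_) (norm_sub_le _ _)
    congr 1
    abel
  -- In units of `1 / (16 N)`: distinct levels are `16` apart up to an error `1`, while overlapping
  -- supports would put them less than `6 + 6` apart.
  nlinarith [mul_le_mul_of_nonneg_left h6 hN'.le, mul_le_mul_of_nonneg_left h3 hN'.le]

theorem exists_circleBump_eq_one {N : ℕ} (hN : 0 < N) {γ : UnitAddCircle}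
    (hγ : ‖γ - ((1 / N : ℝ) : UnitAddCircle)‖ ≤ 1 / (16 * N ^ 2)) (t : UnitAddCircle) :
    ∃ (b : Bool) (g : Fin N), circleBump N b (t - ((g : ℕ) : ℤ) • γ) = 1 := by
  have hN' : (0 : ℝ) < N := by exact_mod_cast hN
  obtain ⟨r, rfl⟩ := QuotientAddGroup.mk_surjective t
  -- The nearest point of the grid `ℤ / (2 N)`: its parity is the colour, and half of it modulo `N`
  -- is the level. It is within `4 / (16 N)`, and the drift of `g • γ` adds `1 / (16 N)`, still on
  -- the plateau of radius `5 / (16 N)`.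
  set q := round (2 * N * r)
  obtain ⟨b, a, hba⟩ : ∃ (b : Bool) (a : ℤ), q = 2 * a + cond b 1 0 := by
    rcases Int.even_or_odd' q with ⟨a, h | h⟩
    · exact ⟨false, a, by simpa using h⟩
    · exact ⟨true, a, by simpa using h⟩
  have hNz : (0 : ℤ) < N := by exact_mod_cast hN
  have hg0 := Int.emod_nonneg a hNz.ne'
  have hg1 := Int.emod_lt_of_pos a hNz
  have hga : ((a % N).toNat : ℤ) = a % N := Int.toNat_of_nonneg hg0
  refine ⟨b, ⟨(a % N).toNat, by omega⟩, circleBump_eq_one ?_⟩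
  simp only [hga]
  set g := a % (N : ℤ)
  have hac : a = g + N * (a / N) := (Int.emod_add_mul_ediv a N).symm
  have h1 := norm_zsmul_sub_le hN hγ g (by rw [abs_of_nonneg hg0]; exact hg1.le)
  set sb : ℝ := cond b (1 / (2 * N)) 0 with hsb
  have hsb' : 2 * N * sb = cond b 1 0 := by
    cases b
    · simp [hsb]
    · simp [hsb]; field_simp
  have hbZ : (((cond b 1 0 : ℤ)) : ℝ) = cond b 1 0 := by cases b <;> simp
  have h2 : 4 * N * ‖((r - g / N - sb : ℝ) : UnitAddCircle)‖ ≤ 1 := by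
    have e : ((r - g / N - sb : ℝ) : UnitAddCircle) =
        ((r - g / N - sb - (a / (N : ℤ) : ℤ) : ℝ) : UnitAddCircle) := by
      rw [AddCircle.coe_sub (1 : ℝ) _ (((a / (N : ℤ) : ℤ)) : ℝ)]
      have : (((a / (N : ℤ) : ℤ) : ℝ) : UnitAddCircle) = 0 := by
        rw [AddCircle.coe_eq_zero_iff]
        exact ⟨a / (N : ℤ), by simp⟩
      rw [this, sub_zero]
    have e2 : 2 * N * (r - g / N - sb - (a / (N : ℤ) : ℤ)) = 2 * N * r - q := by
      have hac' : (a : ℝ) = g + N * ((a / (N : ℤ) : ℤ) : ℝ) := by exact_mod_cast hac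
      rw [hba]
      push_cast
      rw [hbZ, ← hsb', hac']
      field_simp
      ring
    rw [e]
    calc _ ≤ 4 * N * |r - g / N - sb - (a / (N : ℤ) : ℤ)| := by
          gcongr; exact norm_coe_le_abs _
      _ = 2 * |2 * N * (r - g / N - sb - (a / (N : ℤ) : ℤ))| := by
          rw [abs_mul, abs_of_pos (by positivity : (0 : ℝ) < 2 * N)]; ring
      _ ≤ 2 * (1 / 2) := by rw [e2]; gcongr; exact abs_sub_round _
      _ = 1 := by norm_num
  have h3 : ‖(r : UnitAddCircle) - g • γ - (sb : UnitAddCircle)‖ ≤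
      ‖((r - g / N - sb : ℝ) : UnitAddCircle)‖ +
        ‖g • γ - ((g / N : ℝ) : UnitAddCircle)‖ := by
    refine le_trans (le_of_eq ?_) (norm_sub_le _ _)
    congr 1
    rw [AddCircle.coe_sub, AddCircle.coe_sub]
    abel
  have h4 : 16 * N * ‖(r : UnitAddCircle) - g • γ - (sb : UnitAddCircle)‖ ≤ 5 := by
    nlinarith [mul_le_mul_of_nonneg_left h3 hN'.le]
  exact h4

/-! ### Recovering the torus point from one real function. -/

theorem exists_norm_zsmul_sub_lt {α : ℝ} (hα : Irrational α) (t : UnitAddCircle) {ε : ℝ}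
    (hε : 0 < ε) : ∃ m : ℤ, ‖m • (α : UnitAddCircle) - t‖ < ε := by
  have h : DenseRange (· • (α : UnitAddCircle) : ℤ → UnitAddCircle) :=
    AddCircle.denseRange_zsmul_coe_iff.2 (by simpa using hα)
  obtain ⟨m, hm⟩ := h.exists_dist_lt t hε
  exact ⟨m, by rwa [← dist_eq_norm, dist_comm]⟩

theorem torusRotation_apply (α : Fin k → ℝ) (n : Zk k) (x : Torus k) (i : Fin k) :
    torusRotation α n x i = x i + n i • (α i : UnitAddCircle) := by
  rw [torusRotation, ← AddCircle.coe_zsmul, zsmul_eq_mul]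

theorem eq_of_sum_norm_torusRotation_eq {α : Fin k → ℝ} (hα : ∀ i, Irrational (α i))
    {x y : Torus k}
    (h : ∀ n, ∑ i, ‖torusRotation α n x i‖ = ∑ i, ‖torusRotation α n y i‖) : x = y := by
  funext i
  refine eq_of_forall_dist_le fun ε hε => ?_
  have hk : (0 : ℝ) < k := by exact_mod_cast i.pos
  choose n hn using fun i => exists_norm_zsmul_sub_lt (hα i) (-(x i))
    (show 0 < ε / (2 * k) by positivity)
  have hx : ∀ i, ‖torusRotation α n x i‖ < ε / (2 * k) := fun i => by
    rw [torusRotation_apply, add_comm, ← sub_neg_eq_add]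
    exact hn i
  have hsum : ∑ i, ‖torusRotation α n x i‖ ≤ ε / 2 := by
    refine (Finset.sum_le_sum fun i _ => (hx i).le).trans (le_of_eq ?_)
    simp
    field_simp
  have hle : ∀ z : Torus k, ‖torusRotation α n z i‖ ≤ ∑ i, ‖torusRotation α n z i‖ := fun z =>
    Finset.single_le_sum (f := fun i => ‖torusRotation α n z i‖)
      (fun _ _ => norm_nonneg _) (Finset.mem_univ i)
  have h1 := hle x
  have h2 := hle y
  rw [← h] at h2
  calc dist (x i) (y i) = ‖torusRotation α n x i - torusRotation α n y i‖ := by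
        rw [dist_eq_norm, torusRotation_apply, torusRotation_apply, add_sub_add_right_eq_sub]
    _ ≤ _ := norm_sub_le _ _
    _ ≤ ε := by linarith

/-! ### Covers of small order from mean dimension. -/

theorem exists_cover_of_mdim_lt (hk : 0 < k) {L : ℕ} {X : Type*} [MetricSpace X]
    [AddAction (Zk k) X] (h : mdim k X < (L : ℝ≥0∞) / 2) {δ : ℝ} (hδ : 0 < δ) :
    ∃ (N w : ℕ) (U : Set (Set X)), 0 < N ∧ IsFiniteOpenCover U ∧ MeshLE (boxDist k N) U δ ∧
      OrderLE U w ∧ 2 * (w + 1) ≤ N ^ k * L := by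
  obtain ⟨c, hc1, hc2⟩ := exists_between h
  lift c to NNReal using hc2.ne_top
  have hcL : (c : ℝ) < L / 2 := by
    have h2 : ((L : ℝ≥0∞) / 2) = (((L : NNReal) / 2 : NNReal) : ℝ≥0∞) := by
      rw [ENNReal.coe_div two_ne_zero]; simp
    rw [h2, ENNReal.coe_lt_coe] at hc2
    exact_mod_cast hc2
  have hlim := lt_of_le_of_lt (le_iSup₂ (f := fun (ε : ℝ) (_ : 0 < ε) =>
    Filter.liminf (fun n : ℕ => ((widim ε (boxDist k (X := X) n) : ℕ∞) : ℝ≥0∞) / (n : ℝ≥0∞) ^ k)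
      Filter.atTop) δ hδ) hc1
  have hfreq := Filter.frequently_lt_of_liminf_lt (by isBoundedDefault) hlim
  obtain ⟨N, hN, hlt⟩ := Filter.frequently_atTop.1 hfreq (⌈1 / ((L : ℝ) / 2 - c)⌉₊ + 1)
  have hN0 : 0 < N := by omega
  have hpos : 0 < (L : ℝ) / 2 - c := by linarith
  -- The gap below `L / 2`, scaled by a large box, absorbs the `+ 1` in `w + 1`.
  have hNk : 1 ≤ ((L : ℝ) / 2 - c) * N ^ k := by
    have h1 : 1 / ((L : ℝ) / 2 - c) ≤ N :=
      (Nat.le_ceil _).trans (by exact_mod_cast (by omega : ⌈1 / ((L : ℝ) / 2 - c)⌉₊ ≤ N))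
    have h2 : (N : ℝ) ≤ N ^ k := le_self_pow₀ (by exact_mod_cast hN0) hk.ne'
    rw [div_le_iff₀ hpos] at h1
    nlinarith
  rw [ENNReal.div_lt_iff (Or.inl (by positivity)) (Or.inl (by simp))] at hlt
  have hfin : widim δ (boxDist k (X := X) N) ≠ ⊤ := by
    intro ht
    rw [ht] at hlt
    simp at hlt
  obtain ⟨w₀, hw₀⟩ := ENat.ne_top_iff_exists.1 hfin
  have hlt' : widim δ (boxDist k (X := X) N) < ((w₀ + 1 : ℕ) : ℕ∞) := by
    rw [← hw₀]
    exact_mod_cast Nat.lt_succ_self w₀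
  rw [widim] at hlt'
  simp only [iInf_lt_iff] at hlt'
  obtain ⟨w, ⟨U, hU1, hU2, hU3⟩, hw⟩ := hlt'
  refine ⟨N, w, U, hN0, hU1, hU2, hU3, ?_⟩
  have hww : (w : ℝ) ≤ w₀ := by exact_mod_cast Nat.lt_succ_iff.1 (by exact_mod_cast hw)
  rw [← hw₀] at hlt
  have hlt2 : (w₀ : ℝ) < c * N ^ k := by
    have : ((w₀ : NNReal) : ℝ≥0∞) < ((c * N ^ k : NNReal) : ℝ≥0∞) := by
      push_cast
      simpa using hlt
    exact_mod_cast ENNReal.coe_lt_coe.1 this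
  have : (2 * (w + 1) : ℝ) ≤ N ^ k * L := by nlinarith
  exact_mod_cast this

/-! ### Separation inside fibres: openness, perturbation along towers, density. -/

/-- The maps `F` whose orbit map `x ↦ (F (n +ᵥ x))_n` separates all pairs of points at distance at
least `ε` in a common fibre of `π`. -/
def fibreSeparating (k : ℕ) {X Y E : Type*} [MetricSpace X] [AddAction (Zk k) X]
    [TopologicalSpace E] (π : X → Y) (ε : ℝ) : Set C(X, E) :=
  {F | ∀ x y, π x = π y → (∀ n : Zk k, F (n +ᵥ x) = F (n +ᵥ y)) → dist x y < ε}

theorem isOpen_fibreSeparating {X Y E : Type*} [MetricSpace X] [CompactSpace X]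
    [AddAction (Zk k) X] [ContinuousConstVAdd (Zk k) X] [TopologicalSpace Y] [T2Space Y]
    [TopologicalSpace E] [T2Space E] {π : X → Y} (hπ : Continuous π) (ε : ℝ) :
    IsOpen (fibreSeparating k (E := E) π ε) := by
  set S : Set (C(X, E) × (X × X)) := {p | π p.2.1 = π p.2.2 ∧
    (∀ n : Zk k, p.1 (n +ᵥ p.2.1) = p.1 (n +ᵥ p.2.2)) ∧ ε ≤ dist p.2.1 p.2.2} with hS
  have hSc : IsClosed S := by
    have h1 : IsClosed {p : C(X, E) × (X × X) | π p.2.1 = π p.2.2} :=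
      isClosed_eq (by fun_prop) (by fun_prop)
    have h2 : IsClosed {p : C(X, E) × (X × X) |
        ∀ n : Zk k, p.1 (n +ᵥ p.2.1) = p.1 (n +ᵥ p.2.2)} := by
      simp only [Set.ofPred_forall]
      exact isClosed_iInter fun n => isClosed_eq (by fun_prop) (by fun_prop)
    have h3 : IsClosed {p : C(X, E) × (X × X) | ε ≤ dist p.2.1 p.2.2} :=
      isClosed_le (by fun_prop) (by fun_prop)
    exact h1.inter (h2.inter h3)
  -- The failing maps are the projection of the closed set of bad triples along the compact `X × X`.
  have h := isClosedMap_fst_of_compactSpace _ hSc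
  rw [← isClosed_compl_iff]
  convert h using 1
  ext F
  simp only [fibreSeparating, Set.mem_compl_iff, Set.mem_ofPred_eq, Set.mem_image, hS]
  push Not
  constructor
  · rintro ⟨x, y, h1, h2, h3⟩
    exact ⟨(F, x, y), ⟨h1, h2, h3⟩, rfl⟩
  · rintro ⟨⟨F', x, y⟩, ⟨h1, h2, h3⟩, rfl⟩
    exact ⟨x, y, h1, h2, h3⟩

/-- The bump function of colour `c` on the torus, translated to the position `g` of its tower. -/
noncomputable def towerBump {N : ℕ} (γ : Torus k) (c : Fin k → Bool) (g : Fin k → Fin N)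
    (t : Torus k) : ℝ :=
  ∏ i, circleBump N (c i) (t i - ((g i : ℕ) : ℤ) • γ i)

theorem continuous_towerBump {N : ℕ} (γ : Torus k) (c : Fin k → Bool) (g : Fin k → Fin N) :
    Continuous (towerBump γ c g) :=
  continuous_finsetProd _ fun i _ => (continuous_circleBump _ _).comp (by fun_prop)

theorem towerBump_nonneg {N : ℕ} (γ : Torus k) (c : Fin k → Bool) (g : Fin k → Fin N)
    (t : Torus k) : 0 ≤ towerBump γ c g t :=
  Finset.prod_nonneg fun _ _ => circleBump_nonneg _ _ _

theorem towerBump_le_one {N : ℕ} (γ : Torus k) (c : Fin k → Bool) (g : Fin k → Fin N)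
    (t : Torus k) : towerBump γ c g t ≤ 1 :=
  Finset.prod_le_one (fun _ _ => circleBump_nonneg _ _ _) fun _ _ => circleBump_le_one _ _ _

theorem towerBump_disjoint {N : ℕ} {γ : Torus k}
    (hγ : ∀ i, ‖γ i - ((1 / N : ℝ) : UnitAddCircle)‖ ≤ 1 / (16 * N ^ 2)) {c : Fin k → Bool}
    {g g' : Fin k → Fin N} {t : Torus k} (h : towerBump γ c g t ≠ 0)
    (h' : towerBump γ c g' t ≠ 0) : g = g' :=
  funext fun i => circleBump_disjoint (hγ i) (Finset.prod_ne_zero_iff.1 h i (Finset.mem_univ i))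
    (Finset.prod_ne_zero_iff.1 h' i (Finset.mem_univ i))

theorem exists_towerBump_eq_one {N : ℕ} (hN : 0 < N) {γ : Torus k}
    (hγ : ∀ i, ‖γ i - ((1 / N : ℝ) : UnitAddCircle)‖ ≤ 1 / (16 * N ^ 2)) (t : Torus k) :
    ∃ (c : Fin k → Bool) (g : Fin k → Fin N), towerBump γ c g t = 1 := by
  choose c g h using fun i => exists_circleBump_eq_one hN (hγ i) (t i)
  exact ⟨c, g, Finset.prod_eq_one fun i _ => h i⟩

theorem abs_sum_mul_le_of_disjoint {ι : Type*} [Fintype ι] {f e : ι → ℝ} {η : ℝ} (hη : 0 ≤ η)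
    (h0 : ∀ i, 0 ≤ f i) (h1 : ∀ i, f i ≤ 1) (hd : ∀ i j, f i ≠ 0 → f j ≠ 0 → i = j)
    (he : ∀ i, |e i| ≤ η) : |∑ i, f i * e i| ≤ η := by
  by_cases h : ∃ i, f i ≠ 0
  · obtain ⟨i, hi⟩ := h
    rw [Finset.sum_eq_single i]
    · rw [abs_mul, abs_of_nonneg (h0 i)]
      nlinarith [h0 i, h1 i, he i, abs_nonneg (e i)]
    · intro j _ hj
      have : f j = 0 := by
        by_contra h'
        exact hj (hd j i h' hi)
      simp [this]
    · simp
  · push Not at h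
    simpa [h] using hη

theorem exists_perturbation {X : Type*} [MetricSpace X] [CompactSpace X] [AddAction (Zk k) X]
    [ContinuousConstVAdd (Zk k) X] {N L : ℕ} (hN : 0 < N) {γ : Torus k}
    (hγ : ∀ i, ‖γ i - ((1 / N : ℝ) : UnitAddCircle)‖ ≤ 1 / (16 * N ^ 2))
    {θ : X → Torus k} (hθ : Continuous θ)
    (hθe : ∀ (n : Zk k) x i, θ (n +ᵥ x) i = θ x i + n i • γ i) {δ η : ℝ} (hη : 0 ≤ η)
    (F : C(X, (Fin k → Bool) → Fin L → ℝ))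
    (G : (Fin k → Bool) → C(X, (Fin k → Fin N) → Fin L → ℝ))
    (hG : ∀ c x g, dist (G c x g) (F (boxVec g +ᵥ x) c) ≤ η)
    (hGinj : ∀ c x y, G c x = G c y → boxDist k N x y ≤ δ) :
    ∃ F' : C(X, (Fin k → Bool) → Fin L → ℝ), dist F' F ≤ η ∧
      ∀ x y, θ x = θ y → (∀ n : Zk k, F' (n +ᵥ x) = F' (n +ᵥ y)) → dist x y ≤ δ := by
  have hb : ∀ (c) (g : Fin k → Fin N), Continuous fun z => towerBump γ c g (θ z) := fun c g =>
    (continuous_towerBump γ c g).comp hθ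
  -- At level `g` of colour `c`, the value of `F` is interpolated towards entry `g` of the box map
  -- taken at the base point `-g +ᵥ z`.
  set F' : C(X, (Fin k → Bool) → Fin L → ℝ) := ⟨fun z c l => F z c l +
    ∑ g, towerBump γ c g (θ z) * (G c (-(boxVec g : Zk k) +ᵥ z) g l - F z c l), by fun_prop⟩
  have hF'a : ∀ z c l, F' z c l = F z c l +
    ∑ g, towerBump γ c g (θ z) * (G c (-(boxVec g : Zk k) +ᵥ z) g l - F z c l) := fun _ _ _ => rfl
  refine ⟨F', ?_, fun x y hxy h => ?_⟩
  · refine (ContinuousMap.dist_le hη).2 fun z => (dist_pi_le_iff hη).2 fun c =>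
      (dist_pi_le_iff hη).2 fun l => ?_
    rw [Real.dist_eq, hF'a, add_sub_cancel_left]
    refine abs_sum_mul_le_of_disjoint hη (fun _ => towerBump_nonneg _ _ _ _)
      (fun _ => towerBump_le_one _ _ _ _) (fun g g' => towerBump_disjoint hγ) fun g => ?_
    have := (dist_le_pi_dist _ _ l).trans (hG c (-(boxVec g : Zk k) +ᵥ z) g)
    rwa [vadd_vadd, add_neg_cancel, zero_vadd, Real.dist_eq] at this
  · obtain ⟨c, g, hcg⟩ := exists_towerBump_eq_one hN hγ (θ x)
    -- If `z` is on the plateau of level `g`, its translate by `g' - g` is on that of level `g'`,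
    -- over the same base point. The orbit of `F'` thus displays the whole box map there.
    have key : ∀ z, towerBump γ c g (θ z) = 1 → ∀ g' l,
        F' (boxVec g' +ᵥ (-(boxVec g : Zk k) +ᵥ z)) c l = G c (-(boxVec g : Zk k) +ᵥ z) g' l := by
      intro z hz g' l
      have hone : towerBump γ c g' (θ (boxVec g' +ᵥ (-(boxVec g : Zk k) +ᵥ z))) = 1 := by
        rw [← hz]
        refine Finset.prod_congr rfl fun i _ => ?_
        congr 1
        rw [hθe, hθe, Pi.neg_apply, neg_smul]
        simp only [boxVec]
        abel
      rw [hF'a, Finset.sum_eq_single g']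
      · rw [hone, neg_vadd_vadd]
        ring
      · intro g'' _ hne
        have : towerBump γ c g'' (θ (boxVec g' +ᵥ (-(boxVec g : Zk k) +ᵥ z))) = 0 := by
          by_contra h0
          exact hne (towerBump_disjoint hγ h0 (by rw [hone]; exact one_ne_zero))
        rw [this, zero_mul]
      · simp
    have hGG : G c (-(boxVec g : Zk k) +ᵥ x) = G c (-(boxVec g : Zk k) +ᵥ y) := by
      funext g' l
      rw [← key x hcg, ← key y (hxy ▸ hcg), vadd_vadd, vadd_vadd, h]
    have := (dist_boxVec_vadd_le_boxDist g _ _).trans (hGinj c _ _ hGG)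
    rwa [vadd_vadd, vadd_vadd, add_neg_cancel, zero_vadd, zero_vadd] at this

theorem dense_fibreSeparating (hk : 0 < k) {L : ℕ} {X : Type*} [MetricSpace X] [CompactSpace X]
    [AddAction (Zk k) X] [ContinuousConstVAdd (Zk k) X] {α : Fin k → ℝ}
    (hα : ∀ i, Irrational (α i)) {π : X → Torus k} (hπ : IsFactorMap (torusRotation α) π)
    (hmdim : mdim k X < (L : ℝ≥0∞) / 2) {ε : ℝ} (hε : 0 < ε) :
    Dense (fibreSeparating k (E := (Fin k → Bool) → Fin L → ℝ) π ε) := by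
  refine Metric.dense_iff.2 fun F η hη => ?_
  obtain ⟨δ, hδ, hFδ⟩ := Metric.uniformContinuous_iff.1
    (CompactSpace.uniformContinuous_of_continuous F.continuous) (η / 4) (by positivity)
  -- Half the minimum, since mesh bounds are weak inequalities while `hFδ` and the conclusion need
  -- strict ones.
  obtain ⟨N, w, U, hN, hU, hmesh, hord, hw⟩ := exists_cover_of_mdim_lt hk hmdim
    (show 0 < min δ ε / 2 by positivity)
  have hlt : min δ ε / 2 < min δ ε := half_lt_self (by positivity)
  choose G hG hGinj using fun c : Fin k → Bool =>
    exists_box_approx (show 0 < η / 4 by positivity) hU hmesh hord hw (fun x => F x c)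
      (fun x y hxy => (dist_le_pi_dist _ _ c).trans
        (hFδ (hxy.trans_lt (hlt.trans_le (min_le_left _ _)))).le)
  choose m hm using fun i => exists_norm_zsmul_sub_lt (hα i) ((1 / N : ℝ) : UnitAddCircle)
    (show (0 : ℝ) < 1 / (16 * N ^ 2) by positivity)
  -- Multiplying by `m i` turns the rotation by `α i` into one by nearly `1 / N`. Injectivity of
  -- this map is not needed, as only points with equal `π` are compared.
  obtain ⟨F', hF', hsep⟩ := exists_perturbation (θ := fun x i => m i • π x i)
    (γ := fun i => m i • (α i : UnitAddCircle)) hN (fun i => (hm i).le)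
    (by have := hπ.continuous; fun_prop)
    (fun n x i => by
      rw [hπ.equivariant, torusRotation_apply, smul_add, smul_comm])
    (show 0 ≤ 2 * (η / 4) by positivity) F G hG hGinj
  refine ⟨F', Metric.mem_ball.2 (by linarith), fun x y hxy h => ?_⟩
  exact (hsep x y (by simp only [hxy]) h).trans_lt (hlt.trans_le (min_le_right _ _))

theorem exists_fibre_injective (hk : 0 < k) {L : ℕ} {X : Type*} [MetricSpace X] [CompactSpace X]
    [AddAction (Zk k) X] [ContinuousConstVAdd (Zk k) X] {α : Fin k → ℝ}
    (hα : ∀ i, Irrational (α i)) {π : X → Torus k} (hπ : IsFactorMap (torusRotation α) π)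
    (hmdim : mdim k X < (L : ℝ≥0∞) / 2) :
    ∃ F : C(X, (Fin k → Bool) → Fin L → ℝ),
      ∀ x y, π x = π y → (∀ n : Zk k, F (n +ᵥ x) = F (n +ᵥ y)) → x = y := by
  have hD := dense_iInter_of_isOpen
    (fun j : ℕ => isOpen_fibreSeparating (k := k) (E := (Fin k → Bool) → Fin L → ℝ)
      hπ.continuous (1 / ((j : ℝ) + 1)))
    (fun j => dense_fibreSeparating hk hα hπ hmdim (by positivity))
  obtain ⟨F, hF⟩ := hD.nonempty
  rw [Set.mem_iInter] at hF
  refine ⟨F, fun x y hxy h => eq_of_forall_dist_le fun ε hε => ?_⟩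
  obtain ⟨j, hj⟩ := exists_nat_one_div_lt hε
  exact ((hF j x y hxy h).trans hj).le

end MeanDim

/-! ### Assembling the embedding. -/

theorem mainTheorem3 (k : ℕ) (hk : 0 < k) (L : ℕ) (hL : 0 < L)
    (X : Type*) [MetricSpace X] [CompactSpace X]
    [AddAction (MeanDim.Zk k) X] [ContinuousConstVAdd (MeanDim.Zk k) X]
    (α : Fin k → ℝ) (hα : ∀ i, Irrational (α i))
    (hext : ∃ π : X → MeanDim.Torus k, MeanDim.IsFactorMap (MeanDim.torusRotation α) π)
    (hmdim : MeanDim.mdim k X < (L : ENNReal) / 2) :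
    ∃ f : X → MeanDim.CubicalShift k (2 ^ k * L + 1),
      MeanDim.IsSystemEmbedding MeanDim.shift f := by
  obtain ⟨π, hπ⟩ := hext
  obtain ⟨F, hF⟩ := MeanDim.exists_fibre_injective hk hα hπ hmdim
  have e : Fin (2 ^ k * L + 1) ≃ Option ((Fin k → Bool) × Fin L) :=
    (Fintype.equivFinOfCardEq (by simp)).symm
  have hπc := hπ.continuous
  set Φ : X → Option ((Fin k → Bool) × Fin L) → ℝ := fun x o =>
    o.elim (∑ i, ‖π x i‖) fun p => F x p.1 p.2 with hΦ
  have hΦc : ∀ o, Continuous fun x => Φ x o := by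
    rintro (_ | p)
    · simp only [hΦ, Option.elim_none]; fun_prop
    · simp only [hΦ, Option.elim_some]; fun_prop
  -- The sigmoid injects `ℝ` continuously into `[0,1]`, so no bounds on `F` are needed.
  refine ⟨fun x n j => unitInterval.sigmoid (Φ (n +ᵥ x) (e j)), ?_, fun x y hxy => ?_,
    fun n x => ?_⟩
  · refine continuous_pi fun n => continuous_pi fun j => ?_
    exact unitInterval.continuous_sigmoid.comp ((hΦc _).comp (continuous_const_vadd n))
  · have h : ∀ (n : MeanDim.Zk k) o, Φ (n +ᵥ x) o = Φ (n +ᵥ y) o := fun n o => by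
      have := unitInterval.sigmoid_injective (congrFun (congrFun hxy n) (e.symm o))
      rwa [e.apply_symm_apply] at this
    refine hF x y (MeanDim.eq_of_sum_norm_torusRotation_eq hα fun n => ?_) fun n => ?_
    · rw [← hπ.equivariant, ← hπ.equivariant]
      exact h n none
    · funext c l
      exact h n (some (c, l))
  · funext m j
    simp only [MeanDim.shift, vadd_vadd]
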